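/- Let $A$ be a finite alphabet with $|A|\ge 2$. A set $X\subseteq A^*$ is a \emph{code} if every equation $x_1\cdots x_n=y_1\cdots y_p$ among words of $X$ is trivial ($n=p$ and $x_i=y_i$ for all $i$). A code $X$ is \emph{complete} if every word of $A^*$ is a factor of some word of $X^*$. Put $\mu(X)=\sum_{w\in X}|A|^{-|w|}$ (the uniform Bernoulli measure). The factor metric is $d_{\rm F}(w,w')=|w|+|w'|-2|f|$, where $f$ is a maximum length common factor of $w$ and $w'$. For an integer $k\ge 0$ let $\underline{\mathcal F_k}=\{(w,w')\in A^*\times A^* : w\ne w',\ d_{\rm F}(w,w')\le k\}$. A set $X$ is $\underline{\mathcal F_k}$-\emph{independent} if $\underline{\mathcal F_k}(X)\cap X=\emptyset$, that is, if any two distinct words of $X$ are at factor distance greater than $k$. A code is a \emph{maximal $\underline{\mathcal F_k}$-independent code} if it is $\underline{\mathcal F_k}$-independent and is not strictly contained in any $\underline{\mathcal F_k}$-independent code (regular or not). Then: (i) For every $k\ge 0$ and every regular code $X\subseteq A^*$, $X$ is complete if and only if $\mu(X)=1$. If, in addition, $X$ is $\underline{\mathcal F_k}$-independent, the following three conditions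 are equivalent: $X$ is a maximal $\underline{\mathcal F_k}$-independent code; $X$ is complete; $\mu(X)=1$. (ii) There is an algorithm that, given $k\ge 0$ and a finite automaton with behavior $X\subseteq A^*$, decides whether $X$ is a maximal $\underline{\mathcal F_k}$-independent code. In particular this is decidable for regular codes $X$. (iii) For every $k\ge 0$, every regular $\underline{\mathcal F_k}$-independent code is contained in some maximal $\underline{\mathcal F_k}$-independent code. -/

import Mathlib

open scoped Computability ENNReal

namespace FactorCode

/-- A word `f` is a common factor of `w` and `w'`; `w <:+: w'` says that `w` is a (contiguous)
factor of `w'`. -/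
def IsCommonFactor {A : Type*} (w w' f : List A) : Prop :=
  f <:+: w ∧ f <:+: w'

/-- The length of a maximum length common factor of `w` and `w'`. -/
noncomputable def maxFactorLength {A : Type*} (w w' : List A) : ℕ :=
  sSup {n : ℕ | ∃ f : List A, IsCommonFactor w w' f ∧ f.length = n}

/-- The supremum in `maxFactorLength` is a maximum: it is attained by a common factor, and it
bounds the length of every common factor. -/
theorem isGreatest_maxFactorLength {A : Type*} (w w' : List A) :
    IsGreatest {n : ℕ | ∃ f : List A, IsCommonFactor w w' f ∧ f.length = n}
      (maxFactorLength w w') := by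
  have hne : {n : ℕ | ∃ f : List A, IsCommonFactor w w' f ∧ f.length = n}.Nonempty :=
    ⟨0, [], ⟨List.nil_infix, List.nil_infix⟩, rfl⟩
  have hbdd : BddAbove {n : ℕ | ∃ f : List A, IsCommonFactor w w' f ∧ f.length = n} := by
    refine ⟨w.length, ?_⟩
    rintro n ⟨f, hf, rfl⟩
    exact hf.1.length_le
  exact ⟨Nat.sSup_mem hne hbdd, fun n hn => le_csSup hbdd hn⟩

/-- The subtraction in `factorDist` below is never truncated. -/
theorem two_mul_maxFactorLength_le {A : Type*} (w w' : List A) :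
    2 * maxFactorLength w w' ≤ w.length + w'.length := by
  obtain ⟨f, hf, hlen⟩ := (isGreatest_maxFactorLength w w').1
  have h1 := hf.1.length_le
  have h2 := hf.2.length_le
  omega

/-- The factor distance `|w| + |w'| - 2 |f|`, where `f` is a maximum length common factor. -/
noncomputable def factorDist {A : Type*} (w w' : List A) : ℕ :=
  w.length + w'.length - 2 * maxFactorLength w w'

/-- The pairs of words at factor distance at most `k`. -/
def factorRel (A : Type*) (k : ℕ) : SetRel (List A) (List A) :=
  {p | factorDist p.1 p.2 ≤ k}

/-- The anti-reflexive restriction of a binary word relation. -/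
def antiReflexive {A : Type*} (τ : SetRel (List A) (List A)) : SetRel (List A) (List A) :=
  {p | p ∈ τ ∧ p.1 ≠ p.2}

/-- `X` is independent with respect to `τ` when `τ(X) ∩ X = ∅`. -/
def IsIndependent {A : Type*} (τ : SetRel (List A) (List A)) (X : Language A) : Prop :=
  τ.image (X : Set (List A)) ∩ (X : Set (List A)) = ∅

/-- A variable-length code: every equation among words of `X` is trivial. -/
def IsCode {A : Type*} (X : Language A) : Prop :=
  InformationTheory.UniquelyDecodable (X : Set (List A))

/-- `X` is complete: every word is a factor of some word of `X∗`. -/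
def IsComplete {A : Type*} (X : Language A) : Prop :=
  ∀ w : List A, ∃ u ∈ X∗, w <:+: u

/-- `X` is maximal (for inclusion) in the family of all `τ`-independent codes. -/
def IsMaximalIndependentCode {A : Type*} (τ : SetRel (List A) (List A)) (X : Language A) : Prop :=
  Maximal (fun Y : Language A => IsCode Y ∧ IsIndependent τ Y) X

/-- The uniform Bernoulli weight of a word: the multiplicative extension of `a ↦ 1 / |A|`. -/
noncomputable def wordWeight {A : Type*} [Fintype A] (w : List A) : ℝ≥0∞ :=
  (w.map fun _ => (Fintype.card A : ℝ≥0∞)⁻¹).prod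

/-- The uniform Bernoulli measure of a set of words. -/
noncomputable def bernoulli {A : Type*} [Fintype A] (X : Language A) : ℝ≥0∞ :=
  ∑' w : {w : List A // w ∈ X}, wordWeight w.1

/-- A finite automaton over `A` as a finite object that can be given to an algorithm: the list of
its transitions `(q, a, q')`, the list of its initial states and the list of its terminal states,
states being named by natural numbers. -/
abbrev FiniteAutomaton (A : Type*) : Type _ :=
  List (ℕ × A × ℕ) × List ℕ × List ℕ

/-- The automaton presented by such data. -/
def FiniteAutomaton.toNFA {A : Type*} (M : FiniteAutomaton A) : NFA A ℕ where
  step q a := {q' | (q, a, q') ∈ M.1}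
  start := {q | q ∈ M.2.1}
  accept := {q | q ∈ M.2.2}

/-- The behavior of a finite automaton: the labels of its successful paths. -/
def FiniteAutomaton.behavior {A : Type*} (M : FiniteAutomaton A) : Language A :=
  (FiniteAutomaton.toNFA M).accepts

end FactorCode

/-!
Completeness, Bernoulli measure and maximality of codes that are independent for the factor metric.

*Incomplete codes extend* (`exists_insert_of_not_isComplete`). If `w` is a factor of no word of
`X∗`, pad `w` with `k + 1` letters on the left and at least `k` on the right, and choose the
padding so that the resulting word `y` is unbordered. Occurrences of `y` cannot overlap and cannot
lie inside a word of `X∗`, so `X ∪ {y}` is again a code (`IsCode.insert`). A word within factor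
distance `k` of `y` shares with it a factor that misses at most `k` letters of `y`, hence contains
`w`, so no word of `X` is that close (`isInfix_of_factorDist_le`). Therefore maximal independent
codes are complete.

*Measure.* By the Kraft-McMillan inequality `μ(Y) ≤ 1` for every code `Y`. So `μ(X) = 1` leaves no
room for a further word; it implies maximality among all codes, and completeness by the extension
above. Conversely, let `X` be regular and complete. Then `X∗` has finitely many left quotients,
so finitely many contexts `(u, v)` suffice to complete all words, `A∗` is a finite union of sets
`u⁻¹ X∗ v⁻¹`, and `μ(X∗) = ∞` (`IsComplete.bernoulli_kstar`). If `μ(X) < 1`, then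
`μ(X∗) ≤ ∑ μ(X)ⁿ < ∞`, a contradiction.

*Embedding.* Codes and independent sets are of finite character, so Zorn's lemma applies.

*Decidability.* For the behavior of an automaton, maximality amounts to being a code, being
independent, and being complete. Each of the three is a statement quantifying over finitely
many words, and every such word can be replaced by one of computably bounded length with the same
contexts for `X` and `X∗` (`exists_length_le_lengthBound`, pigeonhole on prefixes). For independence
the replacement must also keep `p f s ≠ p' f s'`; that equality is a conjugacy equation `u f = f g`,
and the set of its solutions `g` is one more right-invariant coloring of the words `f`. Hence each
property is a search over a primitive recursive list of words with a primitive recursive test.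
-/

namespace FactorCode

/-! ### Unbordered words and extensions of codes -/

section Words

variable {A : Type*}

/-- A word is unbordered when its only nonempty prefix that is also a suffix is the word itself. -/
def IsUnbordered (y : List A) : Prop :=
  ∀ d : List A, d <+: y → d <:+ y → d ≠ [] → d = y

/-- A border longer than the final block of letters `b` contains the whole prefix `a :: w`, hence
all letters `a`, so nothing can precede it. -/
theorem isUnbordered_cons_append_replicate {a b : A} (hab : a ≠ b) (w : List A) :
    IsUnbordered ((a :: w) ++ List.replicate (w.length + 1) b) := by
  classical
  rintro d hp ⟨r, hr⟩ hd
  rcases eq_or_ne r [] with rfl | hr0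
  · simpa using hr
  exfalso
  have hR : List.count a (List.replicate (w.length + 1) b) = 0 := by
    rw [List.count_eq_zero]
    intro h
    exact hab (List.eq_of_mem_replicate h)
  -- The part `r` cut off in front of a proper border begins with `a`, so the border has fewer
  -- letters `a` than the whole word.
  have hr1 : 0 < List.count a r := by
    obtain ⟨c, r', rfl⟩ := List.exists_cons_of_ne_nil hr0
    simp only [List.cons_append, List.cons.injEq] at hr
    simp [hr.1]
  have hcount := congrArg (List.count a) hr
  rw [List.count_append, List.count_append, hR] at hcount
  rcases le_total d.length (w.length + 1) with hle | hle
  · -- A short border is a suffix of the block of letters `b`, but it begins with `a`.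
    have hsuf : d <:+ List.replicate (w.length + 1) b :=
      List.suffix_of_suffix_length_le ⟨r, hr⟩ (List.suffix_append _ _) (by simpa using hle)
    obtain ⟨c, d', rfl⟩ := List.exists_cons_of_ne_nil hd
    obtain ⟨t, ht⟩ := hp
    simp only [List.cons_append, List.cons.injEq] at ht
    have hc : c ∈ List.replicate (w.length + 1) b := hsuf.subset (by simp)
    exact hab (ht.1.symm.trans (List.eq_of_mem_replicate hc))
  · -- A long border contains `a :: w`, hence every letter `a`.
    have hpre : (a :: w) <+: d :=
      List.prefix_of_prefix_length_le (List.prefix_append _ _) hp (by simpa using hle)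
    have := hpre.sublist.count_le a
    omega

/-- A shift of an unbordered word that is a factor of no word of `X∗` is trivial: occurrences of
an unbordered word cannot overlap, and they cannot lie inside a product of words of `X`. -/
theorem eq_nil_of_shift {X : Language A} {y : List A} (hy : IsUnbordered y)
    (hw : ∀ u ∈ X∗, ¬ y <:+: u) {a b b' c : List A} (ha : a ++ c ∈ X∗)
    (h : y ++ b = c ++ (y ++ b')) : c = [] := by
  rcases List.append_eq_append_iff.1 h with ⟨d, rfl, -⟩ | ⟨d, hd, hd'⟩
  · exact absurd ⟨a, d, by simp⟩ (hw _ ha)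
  · have hpre : d <+: y :=
      List.prefix_of_prefix_length_le ⟨b, hd'.symm⟩ (List.prefix_append y b') (by simp [hd])
    rcases eq_or_ne d [] with rfl | hne
    · rw [List.append_nil] at hd
      subst hd
      exact absurd (List.suffix_append a y).isInfix (hw _ ha)
    · have := hy d hpre ⟨c, hd.symm⟩ hne
      subst this
      simpa using hd

/-- Adjoining to a code an unbordered word that is a factor of no product of code words gives a
code: in any product the occurrences of the new word are exactly the places where it was used. -/
theorem IsCode.insert {X : Language A} (hX : IsCode X) {y : List A} (hy : IsUnbordered y)
    (hw : ∀ u ∈ X∗, ¬ y <:+: u) : IsCode (Insert.insert y X : Language A) := by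
  have hmem : ∀ L : List (List A), (∀ w ∈ L, w ∈ (Insert.insert y X : Language A)) → y ∉ L →
      ∀ w ∈ L, w ∈ X := by
    intro L hL hyL w hwL
    rcases hL w hwL with rfl | h
    · exact absurd hwL hyL
    · exact h
  have hfac : ∀ L : List (List A), y ∈ L → y <:+: L.flatten := fun L h => by
    obtain ⟨s, t, rfl⟩ := List.append_of_mem h
    exact ⟨s.flatten, t.flatten, by simp⟩
  suffices H : ∀ (n : ℕ) (L₁ L₂ : List (List A)), L₁.length ≤ n →
      (∀ w ∈ L₁, w ∈ (Insert.insert y X : Language A)) →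
      (∀ w ∈ L₂, w ∈ (Insert.insert y X : Language A)) →
      L₁.flatten = L₂.flatten → L₁ = L₂ from
    fun L₁ L₂ h₁ h₂ h => H _ L₁ L₂ le_rfl h₁ h₂ h
  intro n
  induction n with
  | zero =>
    intro L₁ L₂ hn h₁ h₂ h
    obtain rfl : L₁ = [] := List.length_eq_zero_iff.1 (Nat.le_zero.1 hn)
    have hy2 : y ∉ L₂ := fun hy2 =>
      hw [] (Language.nil_mem_kstar X) (by simpa [← h] using hfac _ hy2)
    exact hX _ _ (by simp) (hmem L₂ h₂ hy2) h
  | succ n ih =>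
    intro L₁ L₂ hn h₁ h₂ h
    by_cases hy1 : y ∈ L₁
    · by_cases hy2 : y ∈ L₂
      · obtain ⟨s, t, rfl, hs⟩ := List.eq_append_cons_of_mem hy1
        obtain ⟨s', t', rfl, hs'⟩ := List.eq_append_cons_of_mem hy2
        have hsX := hmem s (fun w hw => h₁ w (by simp [hw])) hs
        have hsX' := hmem s' (fun w hw => h₂ w (by simp [hw])) hs'
        have hk := Language.join_mem_kstar hsX
        have hk' := Language.join_mem_kstar hsX'
        simp only [List.flatten_append, List.flatten_cons] at h
        have hflat : s.flatten = s'.flatten := by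
          rcases List.append_eq_append_iff.1 h with ⟨c, hc, hc'⟩ | ⟨c, hc, hc'⟩
          · have := eq_nil_of_shift hy hw (hc ▸ hk') hc'
            simp [hc, this]
          · have := eq_nil_of_shift hy hw (hc ▸ hk) hc'
            simp [hc, this]
        obtain rfl := hX _ _ hsX hsX' hflat
        rw [List.append_cancel_left_eq, List.append_cancel_left_eq] at h
        rw [ih t t' (by simp at hn; omega) (fun w hw => h₁ w (by simp [hw]))
          (fun w hw => h₂ w (by simp [hw])) h]
      · exact absurd (h ▸ hfac _ hy1) (hw _ (Language.join_mem_kstar (hmem L₂ h₂ hy2)))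
    · have hy2 : y ∉ L₂ := fun hy2 =>
        hw _ (Language.join_mem_kstar (hmem L₁ h₁ hy1)) (h ▸ hfac _ hy2)
      exact hX _ _ (hmem L₁ h₁ hy1) (hmem L₂ h₂ hy2) h

/-! ### Independence for the factor metric -/

theorem factorDist_comm (w w' : List A) : factorDist w w' = factorDist w' w := by
  simp only [factorDist, maxFactorLength, IsCommonFactor, and_comm, add_comm]

theorem factorDist_le_iff {w w' : List A} {k : ℕ} :
    factorDist w w' ≤ k ↔ ∃ f, f <:+: w ∧ f <:+: w' ∧ w.length + w'.length ≤ k + 2 * f.length := by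
  obtain ⟨⟨f, hf, hlen⟩, hmax⟩ := isGreatest_maxFactorLength w w'
  have h2 := two_mul_maxFactorLength_le w w'
  unfold factorDist
  constructor
  · intro h
    exact ⟨f, hf.1, hf.2, by omega⟩
  · rintro ⟨g, hg, hg', h⟩
    have : g.length ≤ maxFactorLength w w' := hmax ⟨g, ⟨hg, hg'⟩, rfl⟩
    omega

theorem isIndependent_iff {X : Language A} {k : ℕ} :
    IsIndependent (antiReflexive (factorRel A k)) X ↔
      ∀ x ∈ X, ∀ y ∈ X, x ≠ y → k < factorDist x y := by
  unfold IsIndependent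
  rw [Set.eq_empty_iff_forall_notMem]
  constructor
  · intro h x hx y hy hxy
    by_contra! hle
    exact h y ⟨⟨x, hx, hle, hxy⟩, hy⟩
  · rintro h y ⟨⟨x, hx, hle, hxy⟩, hy⟩
    exact absurd (h x hx y hy hxy) (not_lt.2 hle)

/-- A word within factor distance `k` of `u ++ w ++ v` keeps the middle part `w`, as long as both
margins have length at least `k`. -/
theorem isInfix_of_factorDist_le {u w v x : List A} {k : ℕ} (hu : k ≤ u.length)
    (hv : k ≤ v.length) (h : factorDist (u ++ w ++ v) x ≤ k) : w <:+: x := by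
  obtain ⟨f, ⟨p, s, hps⟩, hfx, hlen⟩ := factorDist_le_iff.1 h
  have hfl := hfx.length_le
  have hps' := congrArg List.length hps
  simp only [List.length_append] at hps' hlen
  refine List.IsInfix.trans ?_ hfx
  obtain ⟨u₁, rfl⟩ : p <+: u :=
    List.prefix_of_prefix_length_le ⟨f ++ s, by simpa using hps⟩ ⟨w ++ v, by simp⟩ (by omega)
  obtain ⟨v₁, rfl⟩ : s <:+ v :=
    List.suffix_of_suffix_length_le ⟨p ++ f, hps⟩ ⟨p ++ u₁ ++ w, by simp⟩ (by omega)
  refine ⟨u₁, v₁, ?_⟩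
  simp only [List.append_assoc, List.append_cancel_left_eq] at hps
  simp only [← List.append_assoc, List.append_cancel_right_eq] at hps
  exact hps.symm

/-- An independent code that is not complete is contained in a strictly larger independent code. -/
theorem exists_insert_of_not_isComplete [Nontrivial A] {X : Language A} (hX : IsCode X)
    (hc : ¬ IsComplete X) (k : ℕ) :
    ∃ y ∉ X, IsCode (insert y X : Language A) ∧
      (IsIndependent (antiReflexive (factorRel A k)) X →
        IsIndependent (antiReflexive (factorRel A k)) (insert y X : Language A)) := by
  obtain ⟨a, b, hab⟩ := exists_pair_ne A
  simp only [IsComplete, not_forall, not_exists, not_and] at hc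
  obtain ⟨w, hw⟩ := hc
  -- The missing word `w`, padded by `k` letters on both sides, then made unbordered.
  set z := List.replicate k a ++ w ++ List.replicate k a with hz
  set R := List.replicate (z.length + 1) b with hR
  set y := (a :: z) ++ R with hy
  have hyw : y = (a :: List.replicate k a) ++ w ++ (List.replicate k a ++ R) := by simp [hy, hz]
  have hwy : w <:+: y := ⟨_, _, hyw.symm⟩
  have hyX : ∀ u ∈ X∗, ¬ y <:+: u := fun u hu h => hw u hu (hwy.trans h)
  have hsub : ∀ x ∈ X, x ∈ X∗ := fun x hx => by
    simpa using Language.join_mem_kstar (l := X) (L := [x]) (by simpa using hx)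
  have hdist : ∀ x ∈ X, k < factorDist y x := by
    intro x hx
    by_contra! hle
    rw [hyw] at hle
    exact hw x (hsub x hx) (isInfix_of_factorDist_le (by simp) (by simp) hle)
  refine ⟨y, fun h => hyX y (hsub y h) (List.infix_refl y),
    hX.insert (isUnbordered_cons_append_replicate hab z) hyX, fun hI => ?_⟩
  rw [isIndependent_iff] at hI ⊢
  rintro x (rfl | hx) x' (rfl | hx') hne
  · exact absurd rfl hne
  · exact hdist _ hx'
  · exact factorDist_comm x _ ▸ hdist _ hx
  · exact hI _ hx _ hx' hne

theorem IsMaximalIndependentCode.isComplete [Nontrivial A] {X : Language A} {k : ℕ}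
    (h : IsMaximalIndependentCode (antiReflexive (factorRel A k)) X) : IsComplete X := by
  by_contra hc
  obtain ⟨y, hy, hcode, hind⟩ := exists_insert_of_not_isComplete h.prop.1 hc k
  exact hy (h.le_of_ge ⟨hcode, hind h.prop.2⟩ (Set.subset_insert y X) (Set.mem_insert y X))

/-- Both defining properties only involve finitely many words at a time, so Zorn's lemma
applies. -/
theorem exists_isMaximalIndependentCode {X : Language A} {k : ℕ} (hX : IsCode X)
    (hI : IsIndependent (antiReflexive (factorRel A k)) X) :
    ∃ Y : Language A, X ≤ Y ∧ IsMaximalIndependentCode (antiReflexive (factorRel A k)) Y := by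
  refine zorn_le_nonempty₀ {Y : Language A | IsCode Y ∧
    IsIndependent (antiReflexive (factorRel A k)) Y} ?_ X ⟨hX, hI⟩
  intro c hc hchain Z hZ
  have hdir : DirectedOn (· ≤ ·) c := hchain.directedOn
  -- Finitely many words of the union of a chain lie in one member of the chain.
  have hfin : ∀ L : List (List A), (∀ w ∈ L, ∃ Y ∈ c, w ∈ Y) → ∃ Y ∈ c, ∀ w ∈ L, w ∈ Y := by
    intro L
    induction L with
    | nil => exact fun _ => ⟨Z, hZ, by simp⟩
    | cons a L ih =>
      intro h
      obtain ⟨Y₁, h₁, h₁'⟩ := h a (by simp)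
      obtain ⟨Y₂, h₂, h₂'⟩ := ih fun w hw => h w (by simp [hw])
      obtain ⟨Y, hY, hl₁, hl₂⟩ := hdir Y₁ h₁ Y₂ h₂
      refine ⟨Y, hY, ?_⟩
      simp only [List.mem_cons, forall_eq_or_imp]
      exact ⟨hl₁ h₁', fun w hw => hl₂ (h₂' w hw)⟩
  refine ⟨{w | ∃ Y ∈ c, w ∈ Y}, ⟨?_, ?_⟩, fun Y hY w hw => ⟨Y, hY, hw⟩⟩
  · intro L₁ L₂ h₁ h₂ h
    obtain ⟨Y, hY, hL⟩ := hfin (L₁ ++ L₂) (by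
      intro w hw
      rcases List.mem_append.1 hw with hw | hw
      exacts [h₁ w hw, h₂ w hw])
    exact (hc hY).1 L₁ L₂ (fun w hw => hL w (by simp [hw])) (fun w hw => hL w (by simp [hw])) h
  · refine isIndependent_iff.2 fun x hx y hy hxy => ?_
    obtain ⟨Y, hY, hL⟩ := hfin [x, y] (by simpa using ⟨hx, hy⟩)
    exact isIndependent_iff.1 (hc hY).2 x (hL x (by simp)) y (hL y (by simp)) hxy

end Words

/-! ### Short representatives for right-invariant colorings -/

section Coloring

variable {A : Type*}

/-- A coloring of words is right-invariant when the color of `x ++ [a]` depends only on `a` and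
the color of `x`. -/
def RightInvariant {S : Type*} (c : List A → S) : Prop :=
  ∀ x y : List A, c x = c y → ∀ a, c (x ++ [a]) = c (y ++ [a])

theorem RightInvariant.append {S : Type*} {c : List A → S} (hc : RightInvariant c)
    {x y : List A} (h : c x = c y) (z : List A) : c (x ++ z) = c (y ++ z) := by
  induction z generalizing x y with
  | nil => simpa using h
  | cons a z ih => simpa using ih (hc x y h a)

theorem RightInvariant.prodMk {S T : Type*} {c : List A → S} {d : List A → T}
    (hc : RightInvariant c) (hd : RightInvariant d) : RightInvariant fun w => (c w, d w) := by
  intro x y h a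
  rw [Prod.mk.injEq] at h ⊢
  exact ⟨hc x y h.1 a, hd x y h.2 a⟩

/-- Pigeonhole on prefixes: two prefixes with the same color allow the word to be shortened. -/
theorem RightInvariant.exists_length_le {S : Type*} {c : List A → S} (hc : RightInvariant c)
    {N : ℕ} (hN : (Set.range c).encard ≤ N) (w : List A) :
    ∃ w' : List A, w'.length ≤ N ∧ c w' = c w := by
  classical
  have hfin : (Set.range c).Finite := Set.finite_of_encard_le_coe hN
  have hcard : hfin.toFinset.card ≤ N := by
    rw [hfin.encard_eq_coe_toFinset_card] at hN
    exact_mod_cast hN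
  induction hl : w.length using Nat.strong_induction_on generalizing w with
  | _ l ih =>
    rcases le_or_gt l N with hle | hlt
    · exact ⟨w, hl ▸ hle, rfl⟩
    · obtain ⟨i, hi, j, hj, hij, heq⟩ := Finset.exists_ne_map_eq_of_card_lt_of_maps_to
        (s := Finset.range (l + 1)) (t := hfin.toFinset) (f := fun i => c (w.take i))
        (by rw [Finset.card_range]; omega) (fun i _ => by simp)
      wlog hlt' : i < j generalizing i j
      · exact this j hj i hi hij.symm heq.symm (by omega)
      simp only [Finset.mem_range] at hi hj
      obtain ⟨w', hw', hcw'⟩ := ih (w.take i ++ w.drop j).length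
        (by simp; omega) (w.take i ++ w.drop j) rfl
      refine ⟨w', hw', ?_⟩
      rw [hcw', hc.append heq, List.take_append_drop]

theorem encard_range_le_card {α S T : Type*} [Finite T] {c : α → S} (d : α → T)
    (h : ∀ x y, d x = d y → c x = c y) : (Set.range c).encard ≤ Nat.card T := by
  have hsub : Set.range c = (fun t : Set.range d => c t.2.choose) '' Set.univ := by
    ext s
    simp only [Set.mem_range, Set.image_univ]
    constructor
    · rintro ⟨x, rfl⟩
      exact ⟨⟨d x, x, rfl⟩, h _ _ (Exists.choose_spec (⟨x, rfl⟩ : ∃ y, d y = d x))⟩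
    · rintro ⟨t, rfl⟩
      exact ⟨_, rfl⟩
  rw [hsub]
  refine (Set.encard_image_le _ _).trans ?_
  rw [Set.encard_univ, ENat.card_eq_coe_natCard]
  exact_mod_cast Finite.card_subtype_le _

theorem encard_range_prodMk_le {α S T : Type*} {c : α → S} {d : α → T} {m n : ℕ}
    (hc : (Set.range c).encard ≤ m) (hd : (Set.range d).encard ≤ n) :
    (Set.range fun x => (c x, d x)).encard ≤ (m * n : ℕ) := by
  have hsub : (Set.range fun x => (c x, d x)) ⊆ Set.range c ×ˢ Set.range d := by
    rintro _ ⟨x, rfl⟩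
    exact ⟨⟨x, rfl⟩, ⟨x, rfl⟩⟩
  refine (Set.encard_le_encard hsub).trans ?_
  rw [Set.encard_prod, Nat.cast_mul]
  exact mul_le_mul' hc hd

/-! ### The syntactic congruence of a language and of its star -/

/-- The contexts of a word with respect to a language. Two words have the same contexts exactly
when they are congruent for the syntactic congruence. -/
def contexts (L : Language A) (w : List A) : Set (List A × List A) :=
  {p | p.1 ++ w ++ p.2 ∈ L}

theorem mem_iff_of_contexts_eq {L : Language A} {w w' : List A}
    (h : contexts L w = contexts L w') (u v : List A) : u ++ w ++ v ∈ L ↔ u ++ w' ++ v ∈ L :=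
  Set.ext_iff.1 h (u, v)

theorem rightInvariant_contexts (L : Language A) : RightInvariant (contexts L) := by
  intro x y h a
  ext ⟨u, v⟩
  simpa [contexts] using mem_iff_of_contexts_eq h u (a :: v)

theorem card_range_le_of_encard_le {α S : Type*} {c : α → S} {n : ℕ}
    (hn : (Set.range c).encard ≤ n) : Finite (Set.range c) ∧ Nat.card (Set.range c) ≤ n := by
  have hfin := Set.finite_of_encard_le_coe hn
  refine ⟨hfin, ?_⟩
  rw [← hfin.cast_ncard_eq] at hn
  exact_mod_cast hn

/-- A word acts on the left quotients of `L`, and this action determines its contexts. -/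
theorem encard_range_contexts_le {L : Language A} {n : ℕ}
    (hn : (Set.range L.leftQuotient).encard ≤ n) :
    (Set.range (contexts L)).encard ≤ (n ^ n : ℕ) := by
  obtain ⟨hfin, hcard⟩ := card_range_le_of_encard_le hn
  refine (encard_range_le_card (T := Set.range L.leftQuotient → Set.range L.leftQuotient)
    (fun w K => ⟨Language.leftQuotient K.1 w, by
      obtain ⟨_, u, rfl⟩ := K
      exact ⟨u ++ w, Language.leftQuotient_append L u w⟩⟩) ?_).trans ?_
  · intro x y h
    ext ⟨u, v⟩
    have h1 := congrArg Subtype.val (congrFun h ⟨L.leftQuotient u, u, rfl⟩)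
    have h2 : v ∈ (L.leftQuotient u).leftQuotient x ↔ v ∈ (L.leftQuotient u).leftQuotient y := by
      exact iff_of_eq (congrArg (v ∈ ·) h1)
    simpa [contexts, Language.mem_leftQuotient] using h2
  · have hpos : 0 < Nat.card (Set.range L.leftQuotient) :=
      Nat.card_pos_iff.2 ⟨⟨⟨L, [], rfl⟩⟩, hfin⟩
    rw [Nat.card_fun]
    exact_mod_cast (Nat.pow_le_pow_left hcard _).trans
      (Nat.pow_le_pow_right (hpos.trans_le hcard) hcard)

/-- A left quotient `u⁻¹L∗` is determined by the left quotients `r⁻¹L` with `u ∈ L∗ r`, and by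
whether `u` belongs to `L∗`. -/
theorem encard_range_leftQuotient_kstar_le {L : Language A} {n : ℕ}
    (hn : (Set.range L.leftQuotient).encard ≤ n) :
    (Set.range L∗.leftQuotient).encard ≤ (2 ^ n * 2 : ℕ) := by
  obtain ⟨hfin, hcard⟩ := card_range_le_of_encard_le hn
  set d : List A → Set (Set.range L.leftQuotient) × Prop := fun u =>
    ({K | ∃ x ∈ L∗, ∃ r, u = x ++ r ∧ L.leftQuotient r = K.1}, u ∈ L∗) with hd
  have key : ∀ u v : List A, v ∈ L∗.leftQuotient u ↔
      ((d u).2 ∧ v ∈ L∗) ∨ ∃ K ∈ (d u).1, v ∈ K.1 * L∗ := by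
    intro u v
    rw [Language.mem_leftQuotient]
    constructor
    · intro h
      obtain ⟨W, hW, hWL⟩ := Language.mem_kstar.1 h
      rcases List.append_eq_flatten_iff.1 hW with ⟨as, bs, rfl, rfl, rfl⟩ |
        ⟨as, bs, c, cs, ds, rfl, rfl, rfl⟩
      · exact Or.inl ⟨Language.join_mem_kstar fun y hy => hWL y (by simp [hy]),
          Language.join_mem_kstar fun y hy => hWL y (by simp [hy])⟩
      · refine Or.inr ⟨⟨L.leftQuotient bs, bs, rfl⟩,
          ⟨as.flatten, Language.join_mem_kstar fun y hy => hWL y (by simp [hy]), bs, rfl, rfl⟩, ?_⟩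
        refine Language.append_mem_mul ?_ (Language.join_mem_kstar fun y hy => hWL y (by simp [hy]))
        exact hWL (bs ++ c :: cs) (by simp)
    · rintro (⟨hu, hv⟩ | ⟨K, ⟨x, hx, r, rfl, hK⟩, hv⟩)
      · obtain ⟨W, rfl, hW⟩ := Language.mem_kstar.1 hu
        obtain ⟨W', rfl, hW'⟩ := Language.mem_kstar.1 hv
        refine Language.mem_kstar.2 ⟨W ++ W', by simp, fun y hy => ?_⟩
        exact (List.mem_append.1 hy).elim (hW y) (hW' y)
      · obtain ⟨a, ha, b, hb, rfl⟩ := Language.mem_mul.1 hv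
        rw [← hK] at ha
        obtain ⟨W, rfl, hW⟩ := Language.mem_kstar.1 hx
        obtain ⟨W', rfl, hW'⟩ := Language.mem_kstar.1 hb
        refine Language.mem_kstar.2 ⟨W ++ (r ++ a) :: W', by simp, fun y hy => ?_⟩
        rcases List.mem_append.1 hy with hy | hy
        · exact hW y hy
        · rcases List.mem_cons.1 hy with rfl | hy
          · exact ha
          · exact hW' y hy
  refine (encard_range_le_card d fun x y h => ?_).trans ?_
  · ext v
    rw [key, key, h]
  · rw [Nat.card_prod]
    have h1 : Nat.card (Set (Set.range L.leftQuotient)) =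
        2 ^ Nat.card (Set.range L.leftQuotient) := by
      have := Fintype.ofFinite (Set.range L.leftQuotient)
      rw [Nat.card_eq_fintype_card, Nat.card_eq_fintype_card, Fintype.card_set]
    rw [h1, Nat.card_eq_fintype_card (α := Prop), Fintype.card_prop]
    exact_mod_cast Nat.mul_le_mul_right 2 (Nat.pow_le_pow_right (by norm_num) hcard)

theorem exists_encard_range_leftQuotient_le {L : Language A} (h : L.IsRegular) :
    ∃ n : ℕ, (Set.range L.leftQuotient).encard ≤ n :=
  ⟨_, h.finite_range_leftQuotient.cast_ncard_eq.ge⟩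

/-! ### Conjugacy equations and short words -/

/-- The words `g` with `u ++ w = w ++ g`. -/
def shifts (u w : List A) : Set (List.Vector A u.length) :=
  {g | u ++ w = w ++ g.1}

theorem append_eq_append_snoc_iff {u w g : List A} {a : A} :
    u ++ (w ++ [a]) = (w ++ [a]) ++ g ↔ ∃ g', u ++ w = w ++ g' ∧ g' ++ [a] = a :: g := by
  constructor
  · intro h
    obtain ⟨g', hg'⟩ : w <+: u ++ w :=
      List.prefix_of_prefix_length_le (l₃ := u ++ (w ++ [a]))
        ⟨a :: g, by simpa using h.symm⟩ ⟨[a], by simp⟩ (by simp)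
    refine ⟨g', hg'.symm, ?_⟩
    rw [← List.append_assoc, ← hg'] at h
    simpa using h
  · rintro ⟨g', h, h'⟩
    rw [← List.append_assoc, h, List.append_assoc, h']
    simp

theorem rightInvariant_shifts (u : List A) : RightInvariant (shifts u) := by
  suffices H : ∀ x y : List A, shifts u x = shifts u y → ∀ a,
      shifts u (x ++ [a]) ⊆ shifts u (y ++ [a]) from
    fun x y h a => (H x y h a).antisymm (H y x h.symm a)
  intro x y h a g hg
  obtain ⟨g', h1, h2⟩ := append_eq_append_snoc_iff.1 hg
  have hlen : g'.length = u.length := by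
    have := congrArg List.length h1
    simp at this
    omega
  have hmem : (⟨g', hlen⟩ : List.Vector A u.length) ∈ shifts u x := h1
  rw [h] at hmem
  exact append_eq_append_snoc_iff.2 ⟨g', hmem, h2⟩

/-- A bound for the length of shortest representatives, for a language with `n` left quotients,
an alphabet with `s` letters, and conjugacy equations with a word of length at most `k`. -/
def lengthBound (s n k : ℕ) : ℕ :=
  n ^ n * ((2 ^ n * 2) ^ (2 ^ n * 2) * (2 * 2 ^ (s ^ k)))

theorem lengthBound_mono {s : ℕ} (hs : 0 < s) (n : ℕ) {k l : ℕ} (h : k ≤ l) :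
    lengthBound s n k ≤ lengthBound s n l := by
  unfold lengthBound
  gcongr
  · norm_num

/-- Every word can be replaced by one of bounded length with the same contexts for `X` and for
`X∗`, the same solutions of a given conjugacy equation, and the same emptiness. -/
theorem exists_length_le_lengthBound [Fintype A] {X : Language A} {n : ℕ}
    (hn : (Set.range X.leftQuotient).encard ≤ n) (u w : List A) :
    ∃ w' : List A, w'.length ≤ lengthBound (Fintype.card A) n u.length ∧
      contexts X w' = contexts X w ∧ contexts X∗ w' = contexts X∗ w ∧ (w' = [] ↔ w = []) ∧
      ∀ g : List A, u ++ w' = w' ++ g ↔ u ++ w = w ++ g := by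
  have hempty : RightInvariant fun w : List A => w = [] := by
    intro x y _ a
    simp
  have hemptyN : (Set.range fun w : List A => w = []).encard ≤ (2 : ℕ) := by
    refine (encard_range_le_card (T := Prop) _ fun x y h => h).trans ?_
    rw [Nat.card_eq_fintype_card, Fintype.card_prop]
  have hshiftN : (Set.range (shifts u)).encard ≤ (2 ^ (Fintype.card A ^ u.length) : ℕ) := by
    refine (encard_range_le_card _ fun x y h => h).trans ?_
    rw [Nat.card_eq_fintype_card, Fintype.card_set, card_vector]
  obtain ⟨w', hlen, hw'⟩ := RightInvariant.exists_length_le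
    ((rightInvariant_contexts X).prodMk
      ((rightInvariant_contexts X∗).prodMk (hempty.prodMk (rightInvariant_shifts u))))
    (encard_range_prodMk_le (encard_range_contexts_le hn) (encard_range_prodMk_le
      (encard_range_contexts_le (encard_range_leftQuotient_kstar_le hn))
      (encard_range_prodMk_le hemptyN hshiftN))) w
  simp only [Prod.mk.injEq] at hw'
  obtain ⟨h1, h2, h3, h4⟩ := hw'
  refine ⟨w', hlen, h1, h2, iff_of_eq h3, ?_⟩
  have hlen' : ∀ {z g : List A}, u ++ z = z ++ g → g.length = u.length := by
    intro z g h
    have := congrArg List.length h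
    simp at this
    omega
  intro g
  constructor
  · exact fun h => (Set.ext_iff.1 h4 ⟨g, hlen' h⟩).1 h
  · exact fun h => (Set.ext_iff.1 h4 ⟨g, hlen' h⟩).2 h

end Coloring

/-! ### The Bernoulli measure -/

section Measure

variable {A : Type*} [Fintype A]

theorem wordWeight_eq (w : List A) :
    wordWeight w = ((Fintype.card A : ℝ≥0∞)⁻¹) ^ w.length := by
  simp [wordWeight]

theorem wordWeight_append (u v : List A) : wordWeight (u ++ v) = wordWeight u * wordWeight v := by
  simp [wordWeight_eq, pow_add]

theorem wordWeight_ne_zero (w : List A) : wordWeight w ≠ 0 := by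
  rw [wordWeight_eq]
  exact pow_ne_zero _ (ENNReal.inv_ne_zero.2 (ENNReal.natCast_ne_top _))

theorem bernoulli_mono {X Y : Language A} (h : X ≤ Y) : bernoulli X ≤ bernoulli Y :=
  ENNReal.tsum_mono_subtype wordWeight h

/-- The Kraft-McMillan inequality for codes that may be infinite. -/
theorem IsCode.bernoulli_le_one [Nonempty A] {X : Language A} (hX : IsCode X) :
    bernoulli X ≤ 1 := by
  classical
  unfold bernoulli
  rw [ENNReal.tsum_eq_iSup_sum]
  refine iSup_le fun s => ?_
  have hcode : InformationTheory.UniquelyDecodable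
      ((s.map (Function.Embedding.subtype _) : Finset (List A)) : Set (List A)) := by
    intro L₁ L₂ h₁ h₂ h
    have hsub : ∀ w ∈ ((s.map (Function.Embedding.subtype _) : Finset (List A)) : Set (List A)),
        w ∈ X := by
      intro w hw
      obtain ⟨x, -, rfl⟩ := Finset.mem_map.1 (Finset.mem_coe.1 hw)
      exact x.2
    exact hX _ _ (fun w hw => hsub w (h₁ w hw)) (fun w hw => hsub w (h₂ w hw)) h
  have hk := InformationTheory.kraft_mcmillan_inequality hcode
  rw [Finset.sum_map] at hk
  have hterm : ∀ w : List A, wordWeight w =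
      ENNReal.ofReal ((1 / (Fintype.card A : ℝ)) ^ w.length) := by
    intro w
    rw [wordWeight_eq, ENNReal.ofReal_pow (by positivity), one_div,
      ENNReal.ofReal_inv_of_pos (by exact_mod_cast Fintype.card_pos), ENNReal.ofReal_natCast]
  simp only [hterm]
  rw [← ENNReal.ofReal_sum_of_nonneg (fun _ _ => by positivity)]
  exact ENNReal.ofReal_le_one.2 hk

theorem bernoulli_insert {X : Language A} {y : List A} (hy : y ∉ X) :
    bernoulli (insert y X : Language A) = wordWeight y + bernoulli X := by
  have hd : Disjoint ({y} : Set (List A)) X := Set.disjoint_singleton_left.2 hy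
  have h := ENNReal.summable.tsum_union_disjoint (f := wordWeight) hd ENNReal.summable
  rw [tsum_singleton] at h
  exact h

/-- The code inequality leaves no room for a further word once the measure is `1`. -/
theorem mem_of_bernoulli_eq_one [Nonempty A] {X Y : Language A} (h1 : bernoulli X = 1)
    (hY : IsCode Y) (hXY : X ≤ Y) {y : List A} (hy : y ∈ Y) : y ∈ X := by
  by_contra hyX
  have hle : (insert y X : Language A) ≤ Y := Set.insert_subset hy hXY
  have := (bernoulli_mono hle).trans hY.bernoulli_le_one
  rw [bernoulli_insert hyX, h1, add_comm] at this
  exact absurd this (not_le.2 (ENNReal.lt_add_right ENNReal.one_ne_top (wordWeight_ne_zero y)))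

theorem isComplete_of_bernoulli_eq_one [Nontrivial A] {X : Language A} (hX : IsCode X)
    (h1 : bernoulli X = 1) : IsComplete X := by
  by_contra hc
  obtain ⟨y, hy, hcode, -⟩ := exists_insert_of_not_isComplete hX hc 0
  exact hy (mem_of_bernoulli_eq_one h1 hcode (Set.subset_insert y X) (Set.mem_insert y X))

theorem tsum_wordWeight [Nonempty A] : ∑' w : List A, wordWeight w = ⊤ := by
  rw [← (Equiv.tsum_eq (List.equivSigmaTuple (α := A)).symm), ENNReal.tsum_sigma']
  have h : ∀ n : ℕ, ∑' f : Fin n → A,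
      wordWeight ((List.equivSigmaTuple (α := A)).symm ⟨n, f⟩) = 1 := by
    intro n
    simp only [List.equivSigmaTuple, Equiv.coe_fn_symm_mk, wordWeight_eq, List.length_ofFn]
    rw [tsum_fintype, Finset.sum_const, Finset.card_univ, Fintype.card_fun, Fintype.card_fin,
      nsmul_eq_mul, Nat.cast_pow, ← mul_pow, ENNReal.mul_inv_cancel (by simp) (by simp), one_pow]
  simp only [h]
  exact ENNReal.tsum_const_eq_top_of_ne_zero one_ne_zero

theorem bernoulli_mul_le (X Y : Language A) : bernoulli (X * Y) ≤ bernoulli X * bernoulli Y := by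
  have hsurj : Function.Surjective (fun p : {w // w ∈ X} × {w // w ∈ Y} =>
      (⟨p.1.1 ++ p.2.1, Language.append_mem_mul p.1.2 p.2.2⟩ : {w : List A // w ∈ X * Y})) := by
    rintro ⟨w, hw⟩
    obtain ⟨a, ha, b, hb, rfl⟩ := Language.mem_mul.1 hw
    exact ⟨(⟨a, ha⟩, ⟨b, hb⟩), rfl⟩
  refine (ENNReal.tsum_le_tsum_comp_of_surjective hsurj _).trans ?_
  simp only [wordWeight_append]
  rw [ENNReal.tsum_prod (f := fun (a : {w // w ∈ X}) (b : {w // w ∈ Y}) =>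
    wordWeight a.1 * wordWeight b.1)]
  simp only [ENNReal.tsum_mul_left, ENNReal.tsum_mul_right]
  exact le_rfl

theorem bernoulli_kstar_le (X : Language A) : bernoulli X∗ ≤ ∑' n : ℕ, bernoulli X ^ n := by
  have hpow : ∀ n : ℕ, bernoulli (X ^ n) ≤ bernoulli X ^ n := by
    intro n
    induction n with
    | zero =>
      have : bernoulli (1 : Language A) = wordWeight ([] : List A) :=
        tsum_singleton ([] : List A) wordWeight
      simp [this, wordWeight_eq]
    | succ n ih =>
      rw [pow_succ, pow_succ]
      exact (bernoulli_mul_le _ _).trans (mul_le_mul_left ih _)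
  have hsub : X∗ ≤ (⋃ n : ℕ, (X ^ n : Language A) : Set (List A)) := by
    intro w hw
    rw [Language.kstar_eq_iSup_pow] at hw
    exact Set.mem_iUnion.2 (Language.mem_iSup.1 hw)
  refine (bernoulli_mono hsub).trans ?_
  exact (ENNReal.tsum_iUnion_le_tsum wordWeight fun n : ℕ => (X ^ n : Language A)).trans
    (ENNReal.tsum_le_tsum hpow)

/-- By regularity of `X∗`, finitely many contexts suffice to complete all words. Hence the set of
all words, which has infinite measure, is a finite union of sets `u⁻¹ X∗ v⁻¹`, and `X∗` has infinite
measure as well. -/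
theorem IsComplete.bernoulli_kstar [Nonempty A] {X : Language A} (hreg : X.IsRegular)
    (hc : IsComplete X) : bernoulli X∗ = ⊤ := by
  classical
  obtain ⟨n, hn⟩ := exists_encard_range_leftQuotient_le hreg
  set N := lengthBound (Fintype.card A) n 0
  set U : Set (List A) := {u | u.length ≤ N} with hU
  have hUfin : U.Finite := List.finite_length_le A N
  by_contra hne
  have hcover : ∀ w : List A, ∃ p ∈ U ×ˢ U, p.1 ++ w ++ p.2 ∈ X∗ := by
    intro w
    obtain ⟨_, hx, u, v, rfl⟩ := hc w
    obtain ⟨u', hu', -, hu, -⟩ := exists_length_le_lengthBound hn [] u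
    obtain ⟨v', hv', -, hv, -⟩ := exists_length_le_lengthBound hn [] v
    refine ⟨(u', v'), ⟨hu', hv'⟩, ?_⟩
    have h1 := (mem_iff_of_contexts_eq hu [] (w ++ v)).2 (by simpa using hx)
    have h2 := (mem_iff_of_contexts_eq hv (u' ++ w) []).2 (by simpa using h1)
    simpa using h2
  have hpiece : ∀ p : List A × List A,
      (∑' w : ({w | p.1 ++ w ++ p.2 ∈ X∗} : Set (List A)), wordWeight w.1) ≠ ⊤ := by
    intro p htop
    apply hne
    have hinj : Function.Injective (fun w : ({w | p.1 ++ w ++ p.2 ∈ X∗} : Set (List A)) =>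
        (⟨p.1 ++ w.1 ++ p.2, w.2⟩ : {w : List A // w ∈ X∗})) := by
      intro w w' h
      simpa [Subtype.ext_iff] using h
    refine top_le_iff.1 (le_trans ?_ (ENNReal.tsum_comp_le_tsum_of_injective hinj _))
    simp only [wordWeight_append]
    rw [ENNReal.tsum_mul_right, ENNReal.tsum_mul_left, htop,
      ENNReal.mul_top (wordWeight_ne_zero _), ENNReal.top_mul (wordWeight_ne_zero _)]
  have hfin := (hUfin.prod hUfin)
  have hle : ∑' w : List A, wordWeight w ≤ ∑ p ∈ hfin.toFinset,
      ∑' w : ({w | p.1 ++ w ++ p.2 ∈ X∗} : Set (List A)), wordWeight w.1 := by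
    rw [← tsum_univ]
    have : (Set.univ : Set (List A)) = ⋃ p ∈ hfin.toFinset, {w | p.1 ++ w ++ p.2 ∈ X∗} := by
      refine (Set.eq_univ_of_forall fun w => ?_).symm
      obtain ⟨p, hp, hw⟩ := hcover w
      exact Set.mem_biUnion (hfin.mem_toFinset.2 hp) hw
    rw [this]
    exact ENNReal.tsum_biUnion_le _ _ _
  rw [tsum_wordWeight, top_le_iff] at hle
  exact ENNReal.sum_ne_top.2 (fun p _ => hpiece p) hle

/-- If `μ(X) < 1`, a geometric series bounds the measure of `X∗`. -/
theorem IsComplete.bernoulli_eq_one [Nonempty A] {X : Language A} (hreg : X.IsRegular)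
    (hX : IsCode X) (hc : IsComplete X) : bernoulli X = 1 := by
  refine le_antisymm hX.bernoulli_le_one ?_
  by_contra! hlt
  have h := bernoulli_kstar_le X
  rw [hc.bernoulli_kstar hreg, ENNReal.tsum_geometric, top_le_iff, ENNReal.inv_eq_top,
    tsub_eq_zero_iff_le] at h
  exact absurd h (not_le.2 hlt)

theorem isComplete_iff_bernoulli_eq_one [Nontrivial A] {X : Language A} (hreg : X.IsRegular)
    (hX : IsCode X) : IsComplete X ↔ bernoulli X = 1 :=
  ⟨fun h => h.bernoulli_eq_one hreg hX, isComplete_of_bernoulli_eq_one hX⟩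

theorem isMaximalIndependentCode_of_bernoulli_eq_one [Nonempty A] {X : Language A} {k : ℕ}
    (hX : IsCode X) (hI : IsIndependent (antiReflexive (factorRel A k)) X)
    (h1 : bernoulli X = 1) : IsMaximalIndependentCode (antiReflexive (factorRel A k)) X :=
  ⟨⟨hX, hI⟩, fun _ hY hXY _ hy => mem_of_bernoulli_eq_one h1 hY.1 hXY hy⟩

theorem isMaximalIndependentCode_iff [Nontrivial A] {X : Language A} (hreg : X.IsRegular) {k : ℕ} :
    IsMaximalIndependentCode (antiReflexive (factorRel A k)) X ↔
      IsCode X ∧ IsIndependent (antiReflexive (factorRel A k)) X ∧ IsComplete X :=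
  ⟨fun h => ⟨h.prop.1, h.prop.2, h.isComplete⟩, fun ⟨hX, hI, hc⟩ =>
    isMaximalIndependentCode_of_bernoulli_eq_one hX hI (hc.bernoulli_eq_one hreg hX)⟩

end Measure

/-! ### Bounded forms of the three properties -/

section Bounds

variable {A : Type*}

/-- Two factorizations first differ where one code word is a proper prefix of the other. -/
theorem not_isCode_iff {X : Language A} :
    ¬ IsCode X ↔ [] ∈ X ∨
      ∃ x t z : List A, t ≠ [] ∧ x ∈ X ∧ x ++ t ∈ X ∧ t ++ z ∈ X∗ ∧ z ∈ X∗ := by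
  constructor
  · intro h
    by_contra! hno
    refine h fun L₁ => ?_
    have key : ∀ (x : List A) (L : List (List A)) (x' : List A) (L' : List (List A)),
        (∀ w ∈ x :: L, w ∈ X) → (∀ w ∈ x' :: L', w ∈ X) → ∀ t, x' = x ++ t →
        L.flatten = t ++ L'.flatten → t = [] := by
      rintro x L _ L' hL hL' t rfl h
      by_contra ht
      exact hno.2 x t L'.flatten ht (hL x (by simp)) (hL' _ (by simp))
        (h ▸ Language.join_mem_kstar fun w hw => hL w (by simp [hw]))
        (Language.join_mem_kstar fun w hw => hL' w (by simp [hw]))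
    induction L₁ with
    | nil =>
      intro L₂ _ h₂ hflat
      cases L₂ with
      | nil => rfl
      | cons b L₂ =>
        have hb : b = [] := by
          have : [] = b ++ L₂.flatten := by simpa using hflat
          exact (List.append_eq_nil_iff.1 this.symm).1
        exact absurd (hb ▸ h₂ b (by simp)) hno.1
    | cons a L₁ ih =>
      intro L₂ h₁ h₂ hflat
      cases L₂ with
      | nil =>
        have ha : a = [] := by
          have : a ++ L₁.flatten = [] := by simpa using hflat
          exact (List.append_eq_nil_iff.1 this).1
        exact absurd (ha ▸ h₁ a (by simp)) hno.1
      | cons b L₂ =>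
        simp only [List.flatten_cons] at hflat
        have hab : a = b := by
          rcases List.append_eq_append_iff.1 hflat with ⟨t, hb, ht⟩ | ⟨t, ha, ht⟩
          · have := key a L₁ b L₂ h₁ h₂ t hb ht
            simp [hb, this]
          · have := key b L₂ a L₁ h₂ h₁ t ha ht
            simp [ha, this]
        subst hab
        rw [List.append_cancel_left_eq] at hflat
        rw [ih L₂ (fun w hw => h₁ w (by simp [hw])) (fun w hw => h₂ w (by simp [hw])) hflat]
  · rintro (h | ⟨x, t, z, ht, hx, hxt, htz, hz⟩) hX
    · exact hX.epsilon_not_mem h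
    · obtain ⟨L, hL, hLX⟩ := Language.mem_kstar.1 htz
      obtain ⟨L', rfl, hLX'⟩ := Language.mem_kstar.1 hz
      have := hX (x :: L) ((x ++ t) :: L')
        (by simpa using ⟨hx, hLX⟩) (by simpa using ⟨hxt, hLX'⟩) (by simp [← hL])
      exact ht (List.self_eq_append_right.1 (List.cons.inj this).1)

theorem append_eq_append_append_iff {f s u s' : List A} :
    f ++ s = u ++ f ++ s' ↔ ∃ g, u ++ f = f ++ g ∧ s = g ++ s' := by
  constructor
  · intro h
    obtain ⟨g, hg⟩ : f <+: u ++ f :=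
      List.prefix_of_prefix_length_le ⟨s, h⟩ (List.prefix_append _ _) (by simp)
    refine ⟨g, hg.symm, ?_⟩
    rw [← hg] at h
    simpa using h
  · rintro ⟨g, h, rfl⟩
    simp [h]

/-- Independence, with the pairs of words at small distance written around a common factor. -/
theorem isIndependent_iff_frames {X : Language A} {k : ℕ} :
    IsIndependent (antiReflexive (factorRel A k)) X ↔
      ∀ p s p' s' f : List A, p.length + s.length + p'.length + s'.length ≤ k →
        p ++ f ++ s ∈ X → p' ++ f ++ s' ∈ X → p ++ f ++ s = p' ++ f ++ s' := by
  rw [isIndependent_iff]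
  constructor
  · intro h p s p' s' f hk hx hx'
    by_contra hne
    refine absurd (h _ hx _ hx' hne) (not_lt.2 ?_)
    refine factorDist_le_iff.2 ⟨f, ⟨p, s, rfl⟩, ⟨p', s', rfl⟩, ?_⟩
    simp only [List.length_append]
    omega
  · intro h x hx y hy hxy
    by_contra! hle
    obtain ⟨f, ⟨p, s, rfl⟩, ⟨p', s', rfl⟩, hlen⟩ := factorDist_le_iff.1 hle
    simp only [List.length_append] at hlen
    exact hxy (h p s p' s' f (by omega) hx hy)

/-- The states reached by a word are initial states or targets of transitions. -/
theorem FiniteAutomaton.encard_range_leftQuotient_le (M : FiniteAutomaton A) :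
    (Set.range M.behavior.leftQuotient).encard ≤ (2 ^ (M.2.1.length + M.1.length) : ℕ) := by
  classical
  set F : Finset ℕ := (M.2.1 ++ M.1.map fun t => t.2.2).toFinset with hF
  have hsub : ∀ w : List A, ∀ q ∈ M.toNFA.evalFrom M.toNFA.start w, q ∈ F := by
    intro w
    induction w using List.reverseRecOn with
    | nil =>
      intro q hq
      have : q ∈ M.2.1 := hq
      simp [hF, this]
    | append_singleton w a _ =>
      intro q hq
      rw [NFA.evalFrom_append, NFA.evalFrom_singleton, NFA.mem_stepSet] at hq
      obtain ⟨r, -, hr⟩ := hq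
      have hr : (r, a, q) ∈ M.1 := hr
      simp only [hF, List.mem_toFinset, List.mem_append, List.mem_map]
      exact Or.inr ⟨_, hr, rfl⟩
  refine (encard_range_le_card
    (fun u => ({q | q.1 ∈ M.toNFA.evalFrom M.toNFA.start u} : Set F)) ?_).trans ?_
  · intro x y h
    have heval : M.toNFA.evalFrom M.toNFA.start x = M.toNFA.evalFrom M.toNFA.start y := by
      ext q
      constructor
      · exact fun hq => (Set.ext_iff.1 h ⟨q, hsub x q hq⟩).1 hq
      · exact fun hq => (Set.ext_iff.1 h ⟨q, hsub y q hq⟩).2 hq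
    ext v
    change x ++ v ∈ M.toNFA.acceptsFrom M.toNFA.start ↔ y ++ v ∈ M.toNFA.acceptsFrom M.toNFA.start
    rw [NFA.append_mem_acceptsFrom, NFA.append_mem_acceptsFrom, heval]
  · rw [Nat.card_eq_fintype_card, Fintype.card_set, Fintype.card_coe]
    have : F.card ≤ M.2.1.length + M.1.length := by
      refine (List.toFinset_card_le _).trans ?_
      simp
    exact_mod_cast Nat.pow_le_pow_right (by norm_num) this

variable [Fintype A]

/-- The common factor of two words can be shortened without changing whether the words are
equal: equality amounts to a conjugacy equation for the factor. -/
theorem exists_length_le_frame [Nonempty A] {X : Language A} {n : ℕ}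
    (hn : (Set.range X.leftQuotient).encard ≤ n) {k : ℕ} {p p' : List A} (hp : p.length ≤ k)
    (hp' : p'.length ≤ k) (s s' f : List A) :
    ∃ f' : List A, f'.length ≤ lengthBound (Fintype.card A) n k ∧ contexts X f' = contexts X f ∧
      (p ++ f' ++ s = p' ++ f' ++ s' ↔ p ++ f ++ s = p' ++ f ++ s') := by
  wlog hle : p.length ≤ p'.length generalizing p p' s s'
  · obtain ⟨f', h1, h2, h3⟩ := this hp' hp s' s (by omega)
    exact ⟨f', h1, h2, by rw [eq_comm, h3, eq_comm]⟩
  by_cases hpre : p <+: p'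
  · obtain ⟨u, rfl⟩ := hpre
    obtain ⟨f', h1, h2, -, -, h3⟩ := exists_length_le_lengthBound hn u f
    refine ⟨f', h1.trans (lengthBound_mono Fintype.card_pos n ?_), h2, ?_⟩
    · simp at hp'
      omega
    · have hred : ∀ z : List A, p ++ z ++ s = p ++ u ++ z ++ s' ↔
          ∃ g, u ++ z = z ++ g ∧ s = g ++ s' := by
        intro z
        rw [← append_eq_append_append_iff]
        simp
      simp only [hred, h3]
  · obtain ⟨f', h1, h2, -⟩ := exists_length_le_lengthBound hn [] f
    refine ⟨f', h1.trans (lengthBound_mono Fintype.card_pos n (by simp)), h2, ?_⟩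
    have hne : ∀ z : List A, p ++ z ++ s ≠ p' ++ z ++ s' := by
      intro z h
      exact hpre (List.prefix_of_prefix_length_le ⟨z ++ s, by simpa using h⟩
        ⟨z ++ s', by simp⟩ hle)
    simp only [hne]

theorem isIndependent_iff_bounded [Nonempty A] {X : Language A} {n : ℕ}
    (hn : (Set.range X.leftQuotient).encard ≤ n) {k : ℕ} :
    IsIndependent (antiReflexive (factorRel A k)) X ↔
      ∀ p s p' s' f : List A, p.length ≤ k → s.length ≤ k → p'.length ≤ k → s'.length ≤ k →
        f.length ≤ lengthBound (Fintype.card A) n k →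
        p.length + s.length + p'.length + s'.length ≤ k →
        p ++ f ++ s ∈ X → p' ++ f ++ s' ∈ X → p ++ f ++ s = p' ++ f ++ s' := by
  rw [isIndependent_iff_frames]
  constructor
  · exact fun h p s p' s' f _ _ _ _ _ hk => h p s p' s' f hk
  · intro h p s p' s' f hk hx hx'
    obtain ⟨f', h1, h2, h3⟩ :=
      exists_length_le_frame hn (k := k) (p := p) (p' := p') (by omega) (by omega) s s' f
    exact h3.1 (h p s p' s' f' (by omega) (by omega) (by omega) (by omega) h1 hk
      ((mem_iff_of_contexts_eq h2 _ _).2 hx) ((mem_iff_of_contexts_eq h2 _ _).2 hx'))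

theorem isCode_iff_bounded {X : Language A} {n : ℕ}
    (hn : (Set.range X.leftQuotient).encard ≤ n) :
    IsCode X ↔ ¬ ([] ∈ X ∨ ∃ x t z : List A, x.length ≤ lengthBound (Fintype.card A) n 0 ∧
      t.length ≤ lengthBound (Fintype.card A) n 0 ∧ z.length ≤ lengthBound (Fintype.card A) n 0 ∧
      t ≠ [] ∧ x ∈ X ∧ x ++ t ∈ X ∧ t ++ z ∈ X∗ ∧ z ∈ X∗) := by
  rw [← not_iff_not, not_isCode_iff, not_not]
  refine or_congr_right ⟨?_, ?_⟩
  · rintro ⟨x, t, z, ht, hx, hxt, htz, hz⟩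
    obtain ⟨x', hx', hxX, -⟩ := exists_length_le_lengthBound hn [] x
    obtain ⟨t', ht', htX, htS, hte, -⟩ := exists_length_le_lengthBound hn [] t
    obtain ⟨z', hz', -, hzS, -⟩ := exists_length_le_lengthBound hn [] z
    refine ⟨x', t', z', hx', ht', hz', fun h => ht (hte.1 h), ?_, ?_, ?_, ?_⟩
    · simpa using (mem_iff_of_contexts_eq hxX [] []).2 (by simpa using hx)
    · have h1 := (mem_iff_of_contexts_eq hxX [] t).2 (by simpa using hxt)
      simpa using (mem_iff_of_contexts_eq htX x' []).2 (by simpa using h1)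
    · have h1 := (mem_iff_of_contexts_eq htS [] z).2 (by simpa using htz)
      simpa using (mem_iff_of_contexts_eq hzS t' []).2 (by simpa using h1)
    · simpa using (mem_iff_of_contexts_eq hzS [] []).2 (by simpa using hz)
  · rintro ⟨x, t, z, -, -, -, h⟩
    exact ⟨x, t, z, h⟩

theorem isComplete_iff_bounded {X : Language A} {n : ℕ}
    (hn : (Set.range X.leftQuotient).encard ≤ n) :
    IsComplete X ↔ ∀ w : List A, w.length ≤ lengthBound (Fintype.card A) n 0 →
      ∃ u v : List A, u.length ≤ lengthBound (Fintype.card A) n 0 ∧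
        v.length ≤ lengthBound (Fintype.card A) n 0 ∧ u ++ w ++ v ∈ X∗ := by
  constructor
  · intro h w _
    obtain ⟨_, hx, u, v, rfl⟩ := h w
    obtain ⟨u', hu', -, hu, -⟩ := exists_length_le_lengthBound hn [] u
    obtain ⟨v', hv', -, hv, -⟩ := exists_length_le_lengthBound hn [] v
    have h1 := (mem_iff_of_contexts_eq hu [] (w ++ v)).2 (by simpa using hx)
    have h2 := (mem_iff_of_contexts_eq hv (u' ++ w) []).2 (by simpa using h1)
    exact ⟨u', v', hu', hv', by simpa using h2⟩
  · intro h w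
    obtain ⟨w', hw', -, hw, -⟩ := exists_length_le_lengthBound hn [] w
    obtain ⟨u, v, -, -, huv⟩ := h w' hw'
    exact ⟨u ++ w ++ v, (mem_iff_of_contexts_eq hw u v).1 huv, u, v, rfl⟩

end Bounds

/-! ### Primitive recursive searches over words -/

/-- The words of length at most `n` over the letters in a list. -/
def wordsLE {α : Type*} (l : List α) : ℕ → List (List α)
  | 0 => [[]]
  | n + 1 => [] :: (wordsLE l n).flatMap fun w => l.map fun a => a :: w

theorem mem_wordsLE {α : Type*} {l : List α} {n : ℕ} {w : List α} :
    w ∈ wordsLE l n ↔ w.length ≤ n ∧ ∀ a ∈ w, a ∈ l := by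
  induction n generalizing w with
  | zero =>
    simp only [wordsLE, List.mem_singleton, Nat.le_zero, List.length_eq_zero_iff]
    exact ⟨fun h => ⟨h, by simp [h]⟩, fun h => h.1⟩
  | succ n ih =>
    cases w with
    | nil => simp [wordsLE]
    | cons a w =>
      simp only [wordsLE, List.mem_cons, List.mem_flatMap, List.mem_map, ih, List.length_cons,
        forall_eq_or_imp, reduceCtorEq, false_or, List.cons.injEq, Nat.add_le_add_iff_right]
      constructor
      · rintro ⟨_, ⟨h1, h2⟩, _, h3, rfl, rfl⟩
        exact ⟨h1, h3, h2⟩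
      · rintro ⟨h1, h3, h2⟩
        exact ⟨w, ⟨h1, h2⟩, a, h3, rfl, rfl⟩

theorem primrec_wordsLE {α : Type*} [Primcodable α] :
    Primrec₂ (wordsLE : List α → ℕ → List (List α)) := by
  have hstep : Primrec₂ fun (l : List α) (p : ℕ × List (List α)) =>
      ([] :: p.2.flatMap fun w => l.map fun a => a :: w : List (List α)) := by
    refine Primrec.list_cons.comp (Primrec.const []) (Primrec.list_flatMap
      (Primrec.snd.comp Primrec.snd) (Primrec.list_map (Primrec.fst.comp Primrec.fst) ?_))
    exact Primrec.list_cons.comp Primrec.snd (Primrec.snd.comp Primrec.fst)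
  refine (Primrec.nat_rec (Primrec.const [[]]) hstep).of_eq fun l n => ?_
  induction n with
  | zero => rfl
  | succ n ih => simp only [ih, wordsLE]

theorem primrecPred_exists_mem {α β : Type*} [Primcodable α] [Primcodable β] {f : α → List β}
    {R : α → β → Prop} (hf : Primrec f) (hR : PrimrecRel R) :
    PrimrecPred fun a => ∃ b ∈ f a, R a b :=
  (PrimrecRel.exists_mem_list hR.swap).comp hf Primrec.id

theorem primrecPred_forall_mem {α β : Type*} [Primcodable α] [Primcodable β] {f : α → List β}
    {R : α → β → Prop} (hf : Primrec f) (hR : PrimrecRel R) :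
    PrimrecPred fun a => ∀ b ∈ f a, R a b :=
  (PrimrecRel.forall_mem_list hR.swap).comp hf Primrec.id

theorem primrecRel_mem {α : Type*} [Primcodable α] :
    PrimrecRel fun (a : α) (l : List α) => a ∈ l := by
  have h : PrimrecPred fun q : (α × List α) × α => q.2 = q.1.1 :=
    Primrec.eq.comp Primrec.snd (Primrec.fst.comp Primrec.fst)
  exact (primrecPred_exists_mem Primrec.snd h.primrecRel).of_eq fun p => by simp

theorem primrec_pow : Primrec₂ ((· ^ ·) : ℕ → ℕ → ℕ) :=
  Primrec₂.unpaired'.1 Nat.Primrec.pow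

theorem primrec_lengthBound (s : ℕ) : Primrec₂ (lengthBound s) := by
  have hn : Primrec fun p : ℕ × ℕ => p.1 := Primrec.fst
  have hm : Primrec fun p : ℕ × ℕ => 2 ^ p.1 * 2 :=
    Primrec.nat_mul.comp (primrec_pow.comp (Primrec.const 2) hn) (Primrec.const 2)
  have hk : Primrec fun p : ℕ × ℕ => 2 * 2 ^ (s ^ p.2) :=
    Primrec.nat_mul.comp (Primrec.const 2) (primrec_pow.comp (Primrec.const 2)
      (primrec_pow.comp (Primrec.const s) Primrec.snd))
  exact Primrec.nat_mul.comp (primrec_pow.comp hn hn)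
    (Primrec.nat_mul.comp (primrec_pow.comp hm hm) hk)

/-! ### Membership in the behavior of an automaton and in its star -/

section Membership

variable {A : Type*}

open Classical in
/-- The list of states reached from the states in `S` by reading the letter `a`. -/
noncomputable def FiniteAutomaton.next (M : FiniteAutomaton A) (S : List ℕ) (a : A) : List ℕ :=
  M.1.filterMap fun t => if t.1 ∈ S ∧ t.2.1 = a then some t.2.2 else none

theorem FiniteAutomaton.mem_behavior_iff {M : FiniteAutomaton A} {w : List A} :
    w ∈ M.behavior ↔ ∃ q ∈ w.foldl M.next M.2.1, q ∈ M.2.2 := by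
  have hfold : ∀ (w : List A) (S : List ℕ),
      {q | q ∈ w.foldl M.next S} = M.toNFA.evalFrom {q | q ∈ S} w := by
    intro w
    induction w with
    | nil => exact fun S => rfl
    | cons a w ih =>
      intro S
      rw [List.foldl_cons, ih, NFA.evalFrom_cons]
      congr 1
      ext q
      rw [NFA.mem_stepSet]
      simp only [FiniteAutomaton.next, List.mem_filterMap, Set.mem_ofPred_eq,
        Option.ite_none_right_eq_some, Option.some.injEq]
      constructor
      · rintro ⟨⟨r, b, q'⟩, ht, ⟨hr, rfl⟩, rfl⟩
        exact ⟨r, hr, ht⟩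
      · rintro ⟨r, hr, ht⟩
        exact ⟨(r, a, q), ht, ⟨hr, rfl⟩, rfl⟩
  have h : ∀ q, q ∈ w.foldl M.next M.2.1 ↔ q ∈ M.toNFA.evalFrom M.toNFA.start w :=
    fun q => Set.ext_iff.1 (hfold w M.2.1) q
  simp only [h]
  constructor
  · rintro ⟨q, hq, hq'⟩
    exact ⟨q, hq', hq⟩
  · rintro ⟨q, hq, hq'⟩
    exact ⟨q, hq', hq⟩

theorem FiniteAutomaton.primrecRel_mem_behavior [Primcodable A] :
    PrimrecRel fun (M : FiniteAutomaton A) (w : List A) => w ∈ M.behavior := by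
  classical
  have hnext : Primrec fun p : FiniteAutomaton A × List ℕ × A =>
      FiniteAutomaton.next p.1 p.2.1 p.2.2 := by
    refine Primrec.listFilterMap (Primrec.fst.comp Primrec.fst) (Primrec.ite
      (PrimrecPred.and ?_ ?_) ?_ (Primrec.const none))
    · exact primrecRel_mem.comp (Primrec.fst.comp Primrec.snd)
        (Primrec.fst.comp (Primrec.snd.comp Primrec.fst))
    · exact Primrec.eq.comp (Primrec.fst.comp (Primrec.snd.comp Primrec.snd))
        (Primrec.snd.comp (Primrec.snd.comp Primrec.fst))
    · exact Primrec.option_some.comp (Primrec.snd.comp (Primrec.snd.comp Primrec.snd))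
  have hfold : Primrec fun p : FiniteAutomaton A × List A =>
      p.2.foldl p.1.next p.1.2.1 :=
    Primrec.list_foldl Primrec.snd (Primrec.fst.comp (Primrec.snd.comp Primrec.fst))
      (hnext.comp (Primrec.pair (Primrec.fst.comp Primrec.fst) Primrec.snd)).to₂
  have haccept : PrimrecPred fun q : (FiniteAutomaton A × List A) × ℕ => q.2 ∈ q.1.1.2.2 :=
    primrecRel_mem.comp Primrec.snd
      (Primrec.snd.comp (Primrec.snd.comp (Primrec.fst.comp Primrec.fst)))
  exact (primrecPred_exists_mem hfold haccept.primrecRel).of_eq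
    fun p => FiniteAutomaton.mem_behavior_iff.symm

/-- A word of `X∗` factors into nonempty words of `X`, so there are at most as many factors as
letters. -/
theorem mem_kstar_iff_exists_mem_wordsLE {X : Language A} {l : List A} (hl : ∀ a, a ∈ l)
    {w : List A} : w ∈ X∗ ↔ ∃ L ∈ wordsLE (wordsLE l w.length) w.length,
      L.flatten = w ∧ ∀ x ∈ L, x ∈ X := by
  constructor
  · intro h
    obtain ⟨L, rfl, hL⟩ := Language.mem_kstar_iff_exists_nonempty.1 h
    refine ⟨L, mem_wordsLE.2 ⟨?_, fun x hx => mem_wordsLE.2 ⟨?_, fun a _ => hl a⟩⟩, rfl,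
      fun x hx => (hL x hx).1⟩
    · rw [List.length_flatten]
      refine le_of_eq_of_le (List.length_map (as := L) List.length).symm
        (List.length_le_sum_of_one_le _ fun i hi => ?_)
      obtain ⟨x, hx, rfl⟩ := List.mem_map.1 hi
      exact List.length_pos_iff.2 (hL x hx).2
    · exact (List.sublist_flatten_of_mem hx).length_le
  · rintro ⟨L, -, rfl, hL⟩
    exact Language.join_mem_kstar hL

theorem FiniteAutomaton.primrecRel_mem_kstar_behavior [Fintype A] [Primcodable A] :
    PrimrecRel fun (M : FiniteAutomaton A) (w : List A) => w ∈ M.behavior∗ := by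
  have hlen : Primrec fun p : FiniteAutomaton A × List A => p.2.length :=
    Primrec.list_length.comp Primrec.snd
  have hwords : Primrec fun p : FiniteAutomaton A × List A =>
      wordsLE (wordsLE Finset.univ.toList p.2.length) p.2.length :=
    primrec_wordsLE.comp
      (primrec_wordsLE.comp (Primrec.const (Finset.univ : Finset A).toList) hlen) hlen
  have hflat : PrimrecPred fun q : (FiniteAutomaton A × List A) × List (List A) =>
      q.2.flatten = q.1.2 :=
    Primrec.eq.comp (Primrec.list_flatten.comp Primrec.snd) (Primrec.snd.comp Primrec.fst)
  have hmem : PrimrecPred fun q : ((FiniteAutomaton A × List A) × List (List A)) × List A =>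
      q.2 ∈ q.1.1.1.behavior :=
    FiniteAutomaton.primrecRel_mem_behavior.comp
      (Primrec.fst.comp (Primrec.fst.comp Primrec.fst)) Primrec.snd
  have hall := primrecPred_forall_mem Primrec.snd hmem.primrecRel
  exact (primrecPred_exists_mem hwords (hflat.and hall).primrecRel).of_eq fun p =>
    (mem_kstar_iff_exists_mem_wordsLE (X := p.1.behavior) (w := p.2)
      fun a => Finset.mem_toList.2 (Finset.mem_univ a)).symm

end Membership

/-! ### Decidability -/

section Decidability

variable {A : Type*} [Fintype A]

/-- The length up to which the searches for an automaton `M` and the tolerance `k` are run. -/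
def FiniteAutomaton.searchBound (M : FiniteAutomaton A) (k : ℕ) : ℕ :=
  lengthBound (Fintype.card A) (2 ^ (M.2.1.length + M.1.length)) k

/-- The list of words of length at most `n` over the whole alphabet. -/
noncomputable def allWordsLE (A : Type*) [Fintype A] (n : ℕ) : List (List A) :=
  wordsLE Finset.univ.toList n

theorem mem_allWordsLE {n : ℕ} {w : List A} : w ∈ allWordsLE A n ↔ w.length ≤ n := by
  simp [allWordsLE, mem_wordsLE]

variable [Primcodable A]

theorem primrec_searchBound :
    Primrec₂ (FiniteAutomaton.searchBound : FiniteAutomaton A → ℕ → ℕ) := by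
  refine (primrec_lengthBound _).comp (primrec_pow.comp (Primrec.const 2)
    (Primrec.nat_add.comp ?_ ?_)) Primrec.snd
  · exact Primrec.list_length.comp (Primrec.fst.comp (Primrec.snd.comp Primrec.fst))
  · exact Primrec.list_length.comp (Primrec.fst.comp Primrec.fst)

theorem primrec_allWordsLE : Primrec (allWordsLE A) :=
  primrec_wordsLE.comp (Primrec.const _) Primrec.id

theorem primrec_allWordsLE_searchBound :
    Primrec fun M : FiniteAutomaton A => allWordsLE A (M.searchBound 0) :=
  primrec_allWordsLE.comp (primrec_searchBound.comp Primrec.id (Primrec.const 0))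

theorem primrecPred_isCode_behavior :
    PrimrecPred fun M : FiniteAutomaton A => IsCode M.behavior := by
  have hW := primrec_allWordsLE_searchBound (A := A)
  have hbody : PrimrecPred fun p : ((FiniteAutomaton A × List A) × List A) × List A =>
      p.1.2 ≠ [] ∧ p.1.1.2 ∈ p.1.1.1.behavior ∧ p.1.1.2 ++ p.1.2 ∈ p.1.1.1.behavior ∧
        p.1.2 ++ p.2 ∈ p.1.1.1.behavior∗ ∧ p.2 ∈ p.1.1.1.behavior∗ := by
    have hz : Primrec fun p : ((FiniteAutomaton A × List A) × List A) × List A => p.2 :=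
      Primrec.snd
    have ht : Primrec fun p : ((FiniteAutomaton A × List A) × List A) × List A => p.1.2 :=
      Primrec.snd.comp Primrec.fst
    have hx : Primrec fun p : ((FiniteAutomaton A × List A) × List A) × List A => p.1.1.2 :=
      Primrec.snd.comp (Primrec.fst.comp Primrec.fst)
    have hM : Primrec fun p : ((FiniteAutomaton A × List A) × List A) × List A => p.1.1.1 :=
      Primrec.fst.comp (Primrec.fst.comp Primrec.fst)
    exact (Primrec.eq.comp ht (Primrec.const [])).not.and
      ((FiniteAutomaton.primrecRel_mem_behavior.comp hM hx).and
      ((FiniteAutomaton.primrecRel_mem_behavior.comp hM (Primrec.list_append.comp hx ht)).and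
      ((FiniteAutomaton.primrecRel_mem_kstar_behavior.comp hM
        (Primrec.list_append.comp ht hz)).and
      (FiniteAutomaton.primrecRel_mem_kstar_behavior.comp hM hz))))
  have h1 := primrecPred_exists_mem (hW.comp (Primrec.fst.comp Primrec.fst)) hbody.primrecRel
  have h2 := primrecPred_exists_mem (hW.comp Primrec.fst) h1.primrecRel
  have h3 := primrecPred_exists_mem hW h2.primrecRel
  have h0 : PrimrecPred fun M : FiniteAutomaton A => [] ∈ M.behavior :=
    FiniteAutomaton.primrecRel_mem_behavior.comp Primrec.id (Primrec.const [])
  refine (h0.or h3).not.of_eq fun M => ?_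
  rw [isCode_iff_bounded M.encard_range_leftQuotient_le]
  simp only [mem_allWordsLE, exists_and_left, FiniteAutomaton.searchBound]

theorem primrecPred_isComplete_behavior :
    PrimrecPred fun M : FiniteAutomaton A => IsComplete M.behavior := by
  have hW := primrec_allWordsLE_searchBound (A := A)
  have hbody : PrimrecPred fun p : ((FiniteAutomaton A × List A) × List A) × List A =>
      p.1.2 ++ p.1.1.2 ++ p.2 ∈ p.1.1.1.behavior∗ :=
    FiniteAutomaton.primrecRel_mem_kstar_behavior.comp
      (Primrec.fst.comp (Primrec.fst.comp Primrec.fst))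
      (Primrec.list_append.comp (Primrec.list_append.comp (Primrec.snd.comp Primrec.fst)
        (Primrec.snd.comp (Primrec.fst.comp Primrec.fst))) Primrec.snd)
  have h1 := primrecPred_exists_mem (hW.comp (Primrec.fst.comp Primrec.fst)) hbody.primrecRel
  have h2 := primrecPred_exists_mem (hW.comp Primrec.fst) h1.primrecRel
  refine (primrecPred_forall_mem hW h2.primrecRel).of_eq fun M => ?_
  rw [isComplete_iff_bounded M.encard_range_leftQuotient_le]
  simp only [mem_allWordsLE, exists_and_left, FiniteAutomaton.searchBound]

theorem primrecPred_isIndependent_behavior [Nonempty A] :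
    PrimrecPred fun p : ℕ × FiniteAutomaton A =>
      IsIndependent (antiReflexive (factorRel A p.1)) p.2.behavior := by
  -- The frame `(p, s, p', s')` and the common factor `f` are collected in one tuple.
  have hbody : PrimrecPred fun q :
      (((((ℕ × FiniteAutomaton A) × List A) × List A) × List A) × List A) × List A =>
      ¬ (q.1.1.1.1.2.length + q.1.1.1.2.length + q.1.1.2.length + q.1.2.length ≤ q.1.1.1.1.1.1 ∧
        q.1.1.1.1.2 ++ q.2 ++ q.1.1.1.2 ∈ q.1.1.1.1.1.2.behavior ∧
        q.1.1.2 ++ q.2 ++ q.1.2 ∈ q.1.1.1.1.1.2.behavior ∧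
        q.1.1.1.1.2 ++ q.2 ++ q.1.1.1.2 ≠ q.1.1.2 ++ q.2 ++ q.1.2) := by
    have e1 := Primrec.fst (α :=
      ((((ℕ × FiniteAutomaton A) × List A) × List A) × List A) × List A) (β := List A)
    have e2 := Primrec.fst.comp e1
    have e3 := Primrec.fst.comp e2
    have e4 := Primrec.fst.comp e3
    have e5 := Primrec.fst.comp e4
    have hk := Primrec.fst.comp e5
    have hM := Primrec.snd.comp e5
    have hp := Primrec.snd.comp e4
    have hs := Primrec.snd.comp e3
    have hp' := Primrec.snd.comp e2
    have hs' := Primrec.snd.comp e1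
    have hf := Primrec.snd (α :=
      ((((ℕ × FiniteAutomaton A) × List A) × List A) × List A) × List A) (β := List A)
    have hlen := Primrec.nat_add.comp (Primrec.nat_add.comp (Primrec.nat_add.comp
      (Primrec.list_length.comp hp) (Primrec.list_length.comp hs))
      (Primrec.list_length.comp hp')) (Primrec.list_length.comp hs')
    have hw := Primrec.list_append.comp (Primrec.list_append.comp hp hf) hs
    have hw' := Primrec.list_append.comp (Primrec.list_append.comp hp' hf) hs'
    exact ((Primrec.nat_le.comp hlen hk).and
      ((FiniteAutomaton.primrecRel_mem_behavior.comp hM hw).and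
      ((FiniteAutomaton.primrecRel_mem_behavior.comp hM hw').and
      (Primrec.eq.comp hw hw').not))).not
  have hW : Primrec fun p : ℕ × FiniteAutomaton A => allWordsLE A (p.2.searchBound p.1) :=
    primrec_allWordsLE.comp (primrec_searchBound.comp Primrec.snd Primrec.fst)
  have hK : Primrec fun p : ℕ × FiniteAutomaton A => allWordsLE A p.1 :=
    primrec_allWordsLE.comp Primrec.fst
  have h1 := primrecPred_forall_mem (hW.comp (Primrec.fst.comp (Primrec.fst.comp
    (Primrec.fst.comp Primrec.fst)))) hbody.primrecRel
  have h2 := primrecPred_forall_mem (hK.comp (Primrec.fst.comp (Primrec.fst.comp Primrec.fst)))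
    h1.primrecRel
  have h3 := primrecPred_forall_mem (hK.comp (Primrec.fst.comp Primrec.fst)) h2.primrecRel
  have h4 := primrecPred_forall_mem (hK.comp Primrec.fst) h3.primrecRel
  refine (primrecPred_forall_mem hK h4.primrecRel).of_eq fun p => ?_
  rw [isIndependent_iff_bounded p.2.encard_range_leftQuotient_le]
  simp only [mem_allWordsLE, not_and, not_not, FiniteAutomaton.searchBound, ne_eq]
  exact ⟨fun h u s u' s' f hu hs hu' hs' hf => h u hu s hs u' hu' s' hs' f hf,
    fun h u hu s hs u' hu' s' hs' f hf => h u s u' s' f hu hs hu' hs' hf⟩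

theorem computablePred_isMaximalIndependentCode_behavior [Nontrivial A] :
    ComputablePred fun p : ℕ × FiniteAutomaton A =>
      IsMaximalIndependentCode (antiReflexive (factorRel A p.1)) p.2.behavior := by
  have h : PrimrecPred fun p : ℕ × FiniteAutomaton A =>
      IsMaximalIndependentCode (antiReflexive (factorRel A p.1)) p.2.behavior := by
    refine ((primrecPred_isCode_behavior.comp Primrec.snd).and
      (primrecPred_isIndependent_behavior.and
        (primrecPred_isComplete_behavior.comp Primrec.snd))).of_eq fun p => ?_
    refine (isMaximalIndependentCode_iff (Language.IsRegular.of_finite_range_leftQuotient ?_)).symm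
    exact Set.finite_of_encard_le_coe p.2.encard_range_leftQuotient_le
  obtain ⟨hdec, hprim⟩ := h
  exact ⟨hdec, hprim.to_comp⟩

end Decidability

end FactorCode

theorem mainTheorem6 {A : Type*} [Fintype A] (hA : 2 ≤ Fintype.card A) :
    -- the three conditions, and the embedding
    (∀ (k : ℕ) (X : Language A), X.IsRegular → FactorCode.IsCode X →
      (FactorCode.IsIndependent (FactorCode.antiReflexive (FactorCode.factorRel A k)) X →
        List.TFAE [
          FactorCode.IsMaximalIndependentCode
            (FactorCode.antiReflexive (FactorCode.factorRel A k)) X,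
          FactorCode.IsComplete X,
          FactorCode.bernoulli X = 1]) ∧
      (FactorCode.IsComplete X ↔ FactorCode.bernoulli X = 1) ∧
      (FactorCode.IsIndependent (FactorCode.antiReflexive (FactorCode.factorRel A k)) X →
        ∃ Y : Language A, X ≤ Y ∧
          FactorCode.IsMaximalIndependentCode
            (FactorCode.antiReflexive (FactorCode.factorRel A k)) Y)) ∧
    -- decidability, uniformly in the tolerance `k` and in a finite automaton for `X`
    (∀ _ : Primcodable A, ComputablePred fun p : ℕ × FactorCode.FiniteAutomaton A =>
      FactorCode.IsMaximalIndependentCode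
        (FactorCode.antiReflexive (FactorCode.factorRel A p.1))
        (FactorCode.FiniteAutomaton.behavior p.2)) := by
  have : Nontrivial A := Fintype.one_lt_card_iff_nontrivial.1 hA
  refine ⟨fun k X hreg hX => ⟨fun hI => ?_, FactorCode.isComplete_iff_bernoulli_eq_one hreg hX,
    fun hI => FactorCode.exists_isMaximalIndependentCode hX hI⟩,
    fun _ => FactorCode.computablePred_isMaximalIndependentCode_behavior⟩
  tfae_have 1 → 2 := fun h => h.isComplete
  tfae_have 2 ↔ 3 := FactorCode.isComplete_iff_bernoulli_eq_one hreg hX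
  tfae_have 3 → 1 := FactorCode.isMaximalIndependentCode_of_bernoulli_eq_one hX hI
  tfae_finish
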